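/- Let $n\ge 3$ and $1\le r_1\le\cdots\le r_n$ be integers such that either $n=3$ and $r_1\ge 2$, or $n\ge 4$. Let $d=\sum_{i=1}^n r_i$, let $K=K_{r_1,\ldots,r_n}$ be the complete multipartite graph with parts of sizes $r_1,\ldots,r_n$, with vertex set identified with $\{1,\ldots,d\}$, and let $\Bbbk$ be a field. Let $P_K=\operatorname{conv}\{\mathbf e_u+\mathbf e_v:\{u,v\}\in E(K)\}\subset\mathbb R^d$ be the edge polytope, $P_K^\circ$ its relative interior, and $\ell=\min\{m\in\mathbb Z_{>0}: mP_K^\circ\cap\mathbb Z^d\neq\emptyset\}$. Let $R=\Bbbk[K]=\Bbbk[t_ut_v:\{u,v\}\in E(K)]\subset\Bbbk[t_1,\ldots,t_d]$ be the edge ring, graded so that each $t_ut_v$ has degree $1$. Let $(h_0,\ldots,h_s)$ be its $h$-vector, defined by $\sum_{m\ge0}(\dim_\Bbbk R_m)t^m=(h_0+h_1t+\cdots+h_st^s)/(1-t)^{\dim R}$ with $h_s\ne0$, where $\dim R$ is the Krull dimension. Let $a(R)$ be the $a$-invariant of $R$, i.e. the degree of this Hilbert series as a rational function of $t$. Then $\ell$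 exists, the Hilbert series has the above form, $\ell=-a(R)$, and: * (a) if $2r_n<d$ and $d$ is even, then $\ell=d/2$ and $h_s=1$; * (b) if $2r_n<d$ and $d$ is odd, then $\ell=(d+1)/2$ and $h_s\ge2$; * (c) if $2r_n\ge d$, then $\ell=r_n+1$ and $h_s\ge2$. -/

import Mathlib

open scoped Pointwise

noncomputable section

namespace SimpleGraph

variable {V : Type*} [Fintype V]

/-- The edge polytope `P_G ⊆ ℝ^V`: the convex hull of the points `ρ(e) = e_u + e_v`, where
`e = {u, v}` runs over the edges of `G`. -/
def edgePolytope (G : SimpleGraph V) : Set (V → ℝ) :=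
  open Classical in
  convexHull ℝ {x | ∃ u v : V, G.Adj u v ∧ x = Pi.single u 1 + Pi.single v 1}

/-- The lattice points `m P_G° ∩ ℤ^V`, where `P_G°` is the relative interior of the edge polytope. -/
def interiorLatticePoints (G : SimpleGraph V) (m : ℕ) : Set (V → ℤ) :=
  {z | (fun v => (z v : ℝ)) ∈ (m : ℝ) • intrinsicInterior ℝ G.edgePolytope}

/-- `ℓ` is the smallest positive integer `m` such that `m P_G°` contains a lattice point. -/
def IsInteriorDegree (G : SimpleGraph V) (l : ℕ) : Prop :=
  IsLeast {m : ℕ | 0 < m ∧ (G.interiorLatticePoints m).Nonempty} l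

variable (k : Type*) [Field k]

/-- The edge ring `k[G] = k[t_u t_v : {u, v} ∈ E(G)]`, a subalgebra of the polynomial ring. -/
def edgeRing (G : SimpleGraph V) : Subalgebra k (MvPolynomial V k) :=
  Algebra.adjoin k {p | ∃ u v : V, G.Adj u v ∧ p = MvPolynomial.X u * MvPolynomial.X v}

/-- The graded piece `k[G]_m`. The generators `t_u t_v` have degree `1` in the edge ring, so this
piece consists of the elements that are homogeneous of degree `2 m` in the variables `t`. -/
def edgeRingPiece (G : SimpleGraph V) (m : ℕ) : Submodule k (MvPolynomial V k) :=
  Subalgebra.toSubmodule (G.edgeRing k) ⊓ MvPolynomial.homogeneousSubmodule V k (2 * m)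

/-- The Hilbert series `∑ m, (dim_k k[G]_m) t^m` of the edge ring. -/
def edgeRingHilbertSeries (G : SimpleGraph V) : PowerSeries ℤ :=
  PowerSeries.mk fun m => (Module.finrank k (G.edgeRingPiece k m) : ℤ)

/-- `h = h_0 + h_1 t + ⋯ + h_s t^s` is the polynomial whose coefficients form the `h`-vector of
`k[G]`: the Hilbert series is `h / (1 - t)^D`, where `D` is the Krull dimension of `k[G]`.
Such an `h` is unique; `s` is its degree and `h_s` its leading coefficient. -/
def IsEdgeRingHPolynomial (G : SimpleGraph V) (h : Polynomial ℤ) : Prop :=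
  ∃ D : ℕ, ringKrullDim (G.edgeRing k) = (D : WithBot ℕ∞) ∧
    G.edgeRingHilbertSeries k * (1 - PowerSeries.X) ^ D = (h : PowerSeries ℤ)

/-- `a` is the `a`-invariant of `k[G]`: the degree of its Hilbert series as a rational function. -/
def IsEdgeRingAInvariant (G : SimpleGraph V) (a : ℤ) : Prop :=
  ∃ p q : Polynomial ℤ, p ≠ 0 ∧ q ≠ 0 ∧
    G.edgeRingHilbertSeries k * (q : PowerSeries ℤ) = (p : PowerSeries ℤ) ∧
    a = (p.natDegree : ℤ) - (q.natDegree : ℤ)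

end SimpleGraph

end

/-!
For `K = K_{r_1, …, r_n}` everything is read off from lattice points. Write `s_i(z)` for the sum of
the coordinates of `z` over the `i`-th part.

* A vector `z ∈ ℕ^d` with `∑ z = 2 m` is a sum of `m` edge vectors if and only if `s_i(z) ≤ m` for
  all `i`: remove an edge between the two parts with the largest sums
  (`exists_edgeVector_add_of_mem_dilateLatticePoints`). Hence `dim R_m` is the number `f m` of such
  vectors (`finrank_edgeRingPiece`).
* The lattice points of `m P°` are the vectors with `∑ z = 2 m`, `z > 0` and `s_i(z) < m`
  (`interiorLatticePoints_nonempty_iff`). Such a `z` minus any edge vector still satisfies the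
  inequalities for `m - 1`, so every segment from an edge vector to `z / m` can be prolonged
  within `P`.
  Let `g m` be the number of these vectors.
* At most one inequality `s_i(z) ≤ m` can fail, so that `f m` is a binomial coefficient minus sums
  of products of two binomial coefficients. This is a polynomial in `m`, and because there are at
  least three parts the same computation with positive vectors shows that its value at `-m` is
  `(-1) ^ (d - 1) * g m` (`exists_ehrhart_polynomial`).
* Such a reciprocity forces the Hilbert series to be `h / (1 - t) ^ d` with `deg h = d - l` and
  leading coefficient `g l`, where `l` is the first positive integer with `g l ≠ 0`
  (`exists_hPolynomial_of_reciprocity`).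
* `d` is the Krull dimension, since each `t_v` is algebraic over `R` (`ringKrullDim_edgeRing`).

It remains to find `l` and to decide whether `g l = 1` (`exists_first_strictLatticePoints`). If
`2 r_n < d` and `d` is even, the all-ones vector is the only strict point in degree `d / 2`. In the
other cases one puts the missing amount on a single vertex outside the largest part, and there are
at least two such vertices.
-/

/-! ### Polynomial reciprocity and rational generating functions -/

open Finset in
lemma coeff_one_sub_X_pow_int (d k : ℕ) :
    PowerSeries.coeff k ((1 - PowerSeries.X : PowerSeries ℤ) ^ d) =
      (-1) ^ k * (d.choose k : ℤ) := by
  have h : (1 - PowerSeries.X : PowerSeries ℤ) ^ d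
      = (((1 - Polynomial.X) ^ d : Polynomial ℤ) : PowerSeries ℤ) := by simp
  rw [h, Polynomial.coeff_coe]
  have h2 : ((1 - Polynomial.X) ^ d : Polynomial ℤ)
      = Polynomial.C ((-1) ^ d) * (Polynomial.X + Polynomial.C (-1)) ^ d := by
    rw [Polynomial.C_pow, ← mul_pow]; congr 1; simp; ring
  rw [h2, Polynomial.coeff_C_mul, Polynomial.coeff_X_add_C_pow]
  rcases le_or_gt k d with hk | hk
  · obtain ⟨e, rfl⟩ := Nat.exists_eq_add_of_le hk
    have : ((-1 : ℤ) ^ e) * (-1) ^ e = 1 := by rw [← mul_pow]; simp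
    rw [Nat.add_sub_cancel_left, pow_add]
    linear_combination ((-1) ^ k * ((k + e).choose k : ℤ)) * this
  · simp [Nat.choose_eq_zero_of_lt hk]

open Finset in
/-- The `d`-th backward difference of a polynomial of degree less than `d` vanishes. -/
lemma sum_neg_one_pow_choose_mul_eval_sub (p : Polynomial ℚ) (d : ℕ) (hp : p.natDegree < d)
    (x : ℚ) : ∑ j ∈ range (d + 1), (-1) ^ j * (d.choose j : ℚ) * p.eval (x - j) = 0 := by
  have h := congrFun (Polynomial.fwdDiff_iter_eq_zero_of_degree_lt hp) (x - d)
  rw [fwdDiff_iter_eq_sum_shift, ← sum_range_reflect] at h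
  rw [← Pi.zero_apply (M := fun _ : ℚ => ℚ) (x - d), ← h]
  refine sum_congr rfl fun j hj => ?_
  have hj' : j ≤ d := by simpa [Nat.lt_succ_iff] using hj
  have e1 : d + 1 - 1 - j = d - j := by omega
  rw [e1, Nat.choose_symm hj', Nat.sub_sub_self hj']
  have e2 : x - d + (d - j) • (1 : ℚ) = x - j := by
    rw [nsmul_eq_mul, Nat.cast_sub hj']; ring
  rw [e2]; simp

open Finset in
/-- Ehrhart-type reciprocity for rational generating functions. If `f` agrees on `ℕ` with a
polynomial `p` of degree less than `d`, and `g` with `m ↦ (-1) ^ (d - 1) * p (-m)` on the positive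
integers, then `∑ f m t ^ m = h / (1 - t) ^ d`, where the top coefficient of `h` is the first
nonzero value `g l`, sitting in degree `d - l`. -/
theorem exists_hPolynomial_of_reciprocity (f g : ℕ → ℤ) (p : Polynomial ℚ) (d l : ℕ)
    (hp : p.natDegree < d) (hf : ∀ m : ℕ, p.eval (m : ℚ) = f m)
    (hg : ∀ m : ℕ, 0 < m → p.eval (-(m : ℚ)) = (-1) ^ (d - 1) * g m)
    (hl : 0 < l) (hld : l ≤ d) (hg0 : ∀ m, 0 < m → m < l → g m = 0) (hgl : g l ≠ 0) :
    ∃ h : Polynomial ℤ, PowerSeries.mk f * (1 - PowerSeries.X) ^ d = (h : PowerSeries ℤ) ∧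
      h.natDegree = d - l ∧ h.leadingCoeff = g l := by
  have hcoeff (K : ℕ) : ((PowerSeries.coeff K
      (PowerSeries.mk f * (1 - PowerSeries.X) ^ d) : ℤ) : ℚ)
      = ∑ j ∈ range (K + 1), (-1) ^ j * (d.choose j : ℚ) * p.eval ((K : ℚ) - j) := by
    rw [mul_comm, PowerSeries.coeff_mul, Nat.sum_antidiagonal_eq_sum_range_succ_mk, Int.cast_sum]
    refine sum_congr rfl fun j hj => ?_
    have hj' : j ≤ K := by simpa [Nat.lt_succ_iff] using hj
    rw [coeff_one_sub_X_pow_int, PowerSeries.coeff_mk, ← Nat.cast_sub hj', hf]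
    push_cast; ring
  have hhigh (K : ℕ) (hK : d ≤ K) :
      PowerSeries.coeff K (PowerSeries.mk f * (1 - PowerSeries.X) ^ d) = 0 := by
    rw [← Int.cast_eq_zero (α := ℚ), hcoeff,
      ← sum_neg_one_pow_choose_mul_eval_sub p d hp K]
    refine (sum_subset (range_subset_range.2 (by omega)) fun j _ hj => ?_).symm
    have : d < j := by simpa [Nat.lt_succ_iff] using hj
    simp [Nat.choose_eq_zero_of_lt this]
  have hlow (K : ℕ) (hK : K < d) :
      PowerSeries.coeff K (PowerSeries.mk f * (1 - PowerSeries.X) ^ d)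
        = ∑ j ∈ Ico (K + 1) (d + 1), (-1) ^ (d - j) * (d.choose j : ℤ) * g (j - K) := by
    apply Int.cast_injective (α := ℚ)
    rw [hcoeff, Int.cast_sum]
    have h0 := sum_neg_one_pow_choose_mul_eval_sub p d hp K
    rw [← sum_range_add_sum_Ico _ (show K + 1 ≤ d + 1 by omega)] at h0
    rw [eq_neg_of_add_eq_zero_left h0, ← sum_neg_distrib]
    refine sum_congr rfl fun j hj => ?_
    obtain ⟨h1, h2⟩ := mem_Ico.1 hj
    have e : (K : ℚ) - j = -((j - K : ℕ) : ℚ) := by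
      rw [Nat.cast_sub (by omega)]; ring
    rw [e, hg _ (by omega)]
    obtain ⟨c, rfl⟩ : ∃ c, d = j + c := ⟨d - j, by omega⟩
    obtain ⟨b, rfl⟩ : ∃ b, j = b + 1 := ⟨j - 1, by omega⟩
    have : ((-1 : ℚ) ^ b) * (-1) ^ b = 1 := by rw [← mul_pow]; simp
    have e1 : b + 1 + c - 1 = b + c := by omega
    rw [e1, Nat.add_sub_cancel_left]
    push_cast
    rw [pow_add, pow_succ]
    linear_combination ((-1) ^ c * (((b + 1 + c).choose (b + 1) : ℕ) : ℚ)
      * (g (b + 1 - K) : ℚ)) * this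
  refine ⟨PowerSeries.trunc d (PowerSeries.mk f * (1 - PowerSeries.X) ^ d), ?_, ?_⟩
  · ext K
    rw [Polynomial.coeff_coe, PowerSeries.coeff_trunc]
    split_ifs with h
    · rfl
    · exact hhigh K (by omega)
  have htop : (PowerSeries.trunc d (PowerSeries.mk f * (1 - PowerSeries.X) ^ d)).coeff (d - l)
      = g l := by
    rw [PowerSeries.coeff_trunc, if_pos (by omega), hlow _ (by omega),
      sum_eq_single_of_mem d (by simp; omega)]
    · have : d - (d - l) = l := by omega
      simp [this]
    · intro j hj hjd
      have := mem_Ico.1 hj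
      rw [hg0 (j - (d - l)) (by omega) (by omega), mul_zero]
  have hdeg : (PowerSeries.trunc d (PowerSeries.mk f * (1 - PowerSeries.X) ^ d)).natDegree
      = d - l := by
    refine le_antisymm (Polynomial.natDegree_le_iff_coeff_eq_zero.2 fun K hK => ?_)
      (Polynomial.le_natDegree_of_ne_zero (by rwa [htop]))
    rw [PowerSeries.coeff_trunc]
    split_ifs with h
    · rw [hlow _ h]
      refine sum_eq_zero fun j hj => ?_
      have := mem_Ico.1 hj
      rw [hg0 (j - K) (by omega) (by omega), mul_zero]
    · rfl
  exact ⟨hdeg, by rw [Polynomial.leadingCoeff, hdeg, htop]⟩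

/-- Faulhaber: an antidifference of `x ^ k`, which is a polynomial of degree at most `k + 1`. -/
lemma exists_antidifference_pow (k : ℕ) : ∃ S : Polynomial ℚ, S.natDegree ≤ k + 1 ∧
    S.eval 0 = 0 ∧ ∀ x : ℚ, S.eval (x + 1) = S.eval x + x ^ k := by
  refine ⟨Polynomial.C ((k + 1 : ℚ)⁻¹) * (Polynomial.bernoulli (k + 1)
    - Polynomial.C ((Polynomial.bernoulli (k + 1)).eval 0)), ?_, by simp, fun x => ?_⟩
  · refine (Polynomial.natDegree_C_mul_le _ _).trans ?_
    refine (Polynomial.natDegree_sub_le _ _).trans ?_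
    simp only [Polynomial.natDegree_C, max_le_iff, Nat.zero_le, and_true]
    refine Polynomial.natDegree_le_iff_coeff_eq_zero.2 fun i hi => ?_
    rw [Polynomial.coeff_bernoulli, if_neg (by omega)]
  · have h := Polynomial.bernoulli_eval_one_add (k + 1) x
    have hk : (k + 1 : ℚ) ≠ 0 := by positivity
    simp only [Polynomial.eval_mul, Polynomial.eval_C, Polynomial.eval_sub]
    rw [add_comm x 1, h]
    push_cast
    field_simp
    simp
    ring

open Finset in
/-- Summing a bivariate polynomial `g (m, c)` over `0 ≤ c < m` gives a polynomial in `m` of degree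
one more, whose values at negative arguments are minus the sums over `-m ≤ c < 0`. -/
theorem exists_polynomial_sum_range (g : MvPolynomial (Fin 2) ℚ) :
    ∃ P : Polynomial ℚ, P.natDegree ≤ g.totalDegree + 1 ∧
      (∀ m : ℕ, P.eval (m : ℚ) = ∑ c ∈ range m, MvPolynomial.eval ![(m : ℚ), (c : ℚ)] g) ∧
      ∀ m : ℕ, P.eval (-(m : ℚ)) =
        -∑ c ∈ range m, MvPolynomial.eval ![-(m : ℚ), -((c : ℚ) + 1)] g := by
  choose S hdeg h0 hS using exists_antidifference_pow
  have hpos (k m : ℕ) : (S k).eval (m : ℚ) = ∑ c ∈ range m, (c : ℚ) ^ k := by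
    induction m with
    | zero => simpa using h0 k
    | succ m ih => rw [sum_range_succ, ← ih, Nat.cast_succ, hS]
  have hneg (k m : ℕ) : (S k).eval (-(m : ℚ)) = -∑ c ∈ range m, (-((c : ℚ) + 1)) ^ k := by
    induction m with
    | zero => simpa using h0 k
    | succ m ih =>
      have h := hS k (-((m : ℚ) + 1))
      rw [show -((m : ℚ) + 1) + 1 = -m by ring, ih] at h
      rw [sum_range_succ, Nat.cast_succ]
      linear_combination -h
  refine ⟨∑ s ∈ g.support, Polynomial.C (g.coeff s) * Polynomial.X ^ s 0 * S (s 1), ?_, ?_, ?_⟩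
  · refine Polynomial.natDegree_sum_le_of_forall_le _ _ fun s hs => ?_
    have h1 := MvPolynomial.le_totalDegree hs
    rw [Finsupp.sum_fintype _ _ (by simp), Fin.sum_univ_two] at h1
    have h2 := hdeg (s 1)
    refine Polynomial.natDegree_mul_le.trans ?_
    have h3 := Polynomial.natDegree_C_mul_X_pow_le (g.coeff s) (s 0)
    omega
  · intro m
    simp_rw [MvPolynomial.eval_eq', Polynomial.eval_finsetSum]
    rw [sum_comm]
    refine sum_congr rfl fun s _ => ?_
    simp [hpos, Fin.prod_univ_two, mul_sum, mul_assoc]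
  · intro m
    simp_rw [MvPolynomial.eval_eq', Polynomial.eval_finsetSum]
    rw [sum_comm, ← sum_neg_distrib]
    refine sum_congr rfl fun s _ => ?_
    simp [hneg, Fin.prod_univ_two, mul_sum, mul_assoc]

lemma eval_preHilbertPoly_natCast (s n : ℕ) :
    (Polynomial.preHilbertPoly ℚ s 0).eval (n : ℚ) = ((n + s).choose s : ℚ) := by
  simpa using Polynomial.preHilbertPoly_eq_choose_sub_add ℚ s (Nat.zero_le n)

/-- Reciprocity for binomial coefficients: `C(-(n+1)+s, s) = (-1)^s C(n, s)`. -/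
lemma eval_preHilbertPoly_neg (s n : ℕ) :
    (Polynomial.preHilbertPoly ℚ s 0).eval (-((n : ℚ) + 1)) = (-1) ^ s * (n.choose s : ℚ) := by
  have : ((s.factorial : ℕ) : ℚ) ≠ 0 := by positivity
  have e : -((n : ℚ) + 1) + 1 = -n := by ring
  simp only [Polynomial.preHilbertPoly, Polynomial.eval_smul, Polynomial.eval_comp,
    Polynomial.eval_add, Polynomial.eval_X, Polynomial.eval_one,
    CharP.cast_eq_zero, map_zero, sub_zero, e, smul_eq_mul]
  rw [ascPochhammer_eval_neg_eq_descPochhammer, descPochhammer_eval_eq_descFactorial,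
    Nat.descFactorial_eq_factorial_mul_choose]
  push_cast
  field_simp

lemma totalDegree_aeval_le {σ : Type*} (p : Polynomial ℚ) (L : MvPolynomial σ ℚ)
    (hL : L.totalDegree ≤ 1) : (Polynomial.aeval L p).totalDegree ≤ p.natDegree := by
  rw [Polynomial.aeval_eq_sum_range]
  refine MvPolynomial.totalDegree_finsetSum_le fun i hi => ?_
  refine (MvPolynomial.totalDegree_smul_le _ _).trans ?_
  refine (MvPolynomial.totalDegree_pow _ _).trans ?_
  have : i ≤ p.natDegree := by simpa [Nat.lt_succ_iff] using hi
  nlinarith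

lemma eval_aeval_mvPolynomial {σ : Type*} (p : Polynomial ℚ) (L : MvPolynomial σ ℚ) (x : σ → ℚ) :
    MvPolynomial.eval x (Polynomial.aeval L p) = p.eval (MvPolynomial.eval x L) := by
  rw [← MvPolynomial.coe_aeval_eq_eval]
  change (MvPolynomial.aeval x) (Polynomial.aeval L p) = _
  rw [← Polynomial.aeval_algHom_apply, Polynomial.coe_aeval_eq_eval]
  rfl

open Finset in
/-- The number of ways to split `2 m` into a sum `c < m` over `q + 1` coordinates and a sum
`2 m - c` over `a + 1` coordinates is a polynomial in `m`, and it satisfies reciprocity. -/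
theorem exists_polynomial_sum_choose_mul_choose (a q : ℕ) :
    ∃ P : Polynomial ℚ, P.natDegree ≤ a + q + 1 ∧
      (∀ m : ℕ, P.eval (m : ℚ) =
        ∑ c ∈ range m, ((2 * m - c + a).choose a : ℚ) * ((c + q).choose q : ℚ)) ∧
      ∀ m : ℕ, P.eval (-(m : ℚ)) = (-1) ^ (a + q + 1) *
        ∑ c ∈ range m, ((2 * m - c - 2).choose a : ℚ) * (c.choose q : ℚ) := by
  set L : MvPolynomial (Fin 2) ℚ := MvPolynomial.C 2 * MvPolynomial.X 0 - MvPolynomial.X 1 with hL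
  have hL1 : L.totalDegree ≤ 1 := by
    refine (MvPolynomial.totalDegree_sub _ _).trans (max_le ?_ ?_)
    · refine (MvPolynomial.totalDegree_mul _ _).trans ?_
      simp
    · simp
  set g := Polynomial.aeval L (Polynomial.preHilbertPoly ℚ a 0) *
    Polynomial.aeval (MvPolynomial.X 1 : MvPolynomial (Fin 2) ℚ) (Polynomial.preHilbertPoly ℚ q 0)
    with hg
  have hgdeg : g.totalDegree ≤ a + q := by
    refine (MvPolynomial.totalDegree_mul _ _).trans (add_le_add ?_ ?_)
    · exact (totalDegree_aeval_le _ _ hL1).trans (Polynomial.natDegree_preHilbertPoly ℚ a 0).le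
    · exact (totalDegree_aeval_le _ _ (by simp)).trans
        (Polynomial.natDegree_preHilbertPoly ℚ q 0).le
  have hgeval (x y : ℚ) : MvPolynomial.eval ![x, y] g =
      (Polynomial.preHilbertPoly ℚ a 0).eval (2 * x - y) *
        (Polynomial.preHilbertPoly ℚ q 0).eval y := by
    simp [hg, hL, eval_aeval_mvPolynomial]
  obtain ⟨P, hP, hpos, hneg⟩ := exists_polynomial_sum_range g
  refine ⟨P, by omega, fun m => ?_, fun m => ?_⟩
  · rw [hpos]
    refine sum_congr rfl fun c hc => ?_
    have hc' : c < m := by simpa using hc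
    have e : 2 * (m : ℚ) - c = ((2 * m - c : ℕ) : ℚ) := by
      rw [Nat.cast_sub (by omega)]; push_cast; ring
    rw [hgeval, e, eval_preHilbertPoly_natCast, eval_preHilbertPoly_natCast]
  · rw [hneg, ← sum_neg_distrib, mul_sum]
    refine sum_congr rfl fun c hc => ?_
    have hc' : c < m := by simpa using hc
    have e : 2 * -(m : ℚ) - -((c : ℚ) + 1) = -(((2 * m - c - 2 : ℕ) : ℚ) + 1) := by
      obtain ⟨b, rfl⟩ : ∃ b, m = c + 1 + b := ⟨m - c - 1, by omega⟩
      have : 2 * (c + 1 + b) - c - 2 = c + 2 * b := by omega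
      rw [this]; push_cast; ring
    rw [hgeval, e, eval_preHilbertPoly_neg, eval_preHilbertPoly_neg]
    ring

/-! ### Lattice points and sums of edges -/

/-- With at least three nonempty parts, some vertex avoids any two prescribed parts. -/
lemma exists_apply_notMem_of_card_le_two {V ι : Type*} [Fintype ι] {π : V → ι}
    (hπ : Function.Surjective π) (hι : 2 < Fintype.card ι) (s : Finset ι) (hs : s.card ≤ 2) :
    ∃ v, π v ∉ s := by
  by_contra! h
  have h1 := Finset.card_le_card
    (fun x _ => by obtain ⟨v, rfl⟩ := hπ x; exact h v : (Finset.univ : Finset ι) ⊆ s)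
  rw [Finset.card_univ] at h1
  omega

/-- The indicator vector of the pair `{u, v}`. -/
def edgeVector {V : Type*} [DecidableEq V] (u v : V) : V → ℕ := Pi.single u 1 + Pi.single v 1

lemma edgeVector_le {V : Type*} [DecidableEq V] {u v : V} (huv : u ≠ v) {z : V → ℕ} (hu : 0 < z u)
    (hv : 0 < z v) : edgeVector u v ≤ z := by
  intro x
  simp only [edgeVector, Pi.add_apply, Pi.single_apply]
  split_ifs with h1 h2 h2
  · exact absurd (h1.symm.trans h2) huv
  · subst h1; omega
  · subst h2; omega
  · omega

section PartSum

variable {V ι : Type*} [Fintype V] [DecidableEq ι]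

/-- The sum of the coordinates of `z` over the part `{v | π v = i}`. The map `π : V → ι` records
the part of the multipartition of `V` to which a vertex belongs. -/
def partSum {M : Type*} [AddCommMonoid M] (π : V → ι) (z : V → M) (i : ι) : M :=
  ∑ v with π v = i, z v

lemma sum_partSum {M : Type*} [AddCommMonoid M] [Fintype ι] (π : V → ι) (z : V → M) :
    ∑ i, partSum π z i = ∑ v, z v :=
  Finset.sum_fiberwise _ _ _

lemma partSum_add {M : Type*} [AddCommMonoid M] (π : V → ι) (z w : V → M) (i : ι) :
    partSum π (z + w) i = partSum π z i + partSum π w i :=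
  Finset.sum_add_distrib

lemma partSum_single {M : Type*} [AddCommMonoid M] [DecidableEq V] (π : V → ι) (u : V) (a : M)
    (i : ι) : partSum π (Pi.single u a) i = if π u = i then a else 0 := by
  simp [partSum, Finset.sum_pi_single']

/-- The lattice points of the `m`-th dilate of the polytope
`{x ≥ 0, ∑ x = 2, every part sum at most 1}`. -/
def dilateLatticePoints (π : V → ι) (m : ℕ) : Set (V → ℕ) :=
  {z | ∑ v, z v = 2 * m ∧ ∀ i, partSum π z i ≤ m}

/-- The points of `dilateLatticePoints π m` at which all inequalities are strict. -/
def strictLatticePoints (π : V → ι) (m : ℕ) : Set (V → ℕ) :=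
  {z | ∑ v, z v = 2 * m ∧ (∀ v, 0 < z v) ∧ ∀ i, partSum π z i < m}

lemma sum_edgeVector [DecidableEq V] (u v : V) : ∑ x, edgeVector u v x = 2 := by
  simp [edgeVector, Finset.sum_add_distrib, Finset.sum_pi_single']

lemma partSum_edgeVector [DecidableEq V] (π : V → ι) (u v : V) (i : ι) :
    partSum π (edgeVector u v) i = (if π u = i then 1 else 0) + (if π v = i then 1 else 0) := by
  rw [edgeVector, partSum_add, partSum_single, partSum_single]

lemma exists_pos_of_partSum_pos {π : V → ι} {z : V → ℕ} {i : ι} (h : 0 < partSum π z i) :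
    ∃ v, π v = i ∧ 0 < z v := by
  obtain ⟨v, hv, hz⟩ := Finset.exists_ne_zero_of_sum_ne_zero h.ne'
  exact ⟨v, by simpa using hv, Nat.pos_of_ne_zero hz⟩

/-- A nonzero lattice point is an edge vector plus a lattice point of the previous dilate: take
an edge between the two parts with the largest part sums. -/
theorem exists_edgeVector_add_of_mem_dilateLatticePoints [Fintype ι] [DecidableEq V] {π : V → ι}
    {m : ℕ} {z : V → ℕ} (hz : z ∈ dilateLatticePoints π (m + 1)) :
    ∃ u v, π u ≠ π v ∧ ∃ w ∈ dilateLatticePoints π m, z = edgeVector u v + w := by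
  obtain ⟨hsum, hpart⟩ := hz
  have htot := sum_partSum π z
  have hne : (Finset.univ : Finset ι).Nonempty := by
    by_contra h
    rw [Finset.not_nonempty_iff_eq_empty] at h
    rw [h, Finset.sum_empty] at htot
    omega
  obtain ⟨i, -, hi⟩ := Finset.exists_max_image Finset.univ (partSum π z) hne
  have hsplit := Finset.add_sum_erase Finset.univ (partSum π z) (Finset.mem_univ i)
  have hne' : (Finset.univ.erase i).Nonempty := by
    by_contra h
    rw [Finset.not_nonempty_iff_eq_empty] at h
    rw [h, Finset.sum_empty] at hsplit
    have := hpart i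
    omega
  obtain ⟨j, hjm, hj⟩ := Finset.exists_max_image (Finset.univ.erase i) (partSum π z) hne'
  have hji : j ≠ i := Finset.ne_of_mem_erase hjm
  have hjpos : 0 < partSum π z j := by
    by_contra h
    have : ∑ x ∈ Finset.univ.erase i, partSum π z x = 0 :=
      Finset.sum_eq_zero fun x hx => by have := hj x hx; omega
    have := hpart i
    omega
  have hipos : 0 < partSum π z i := hjpos.trans_le (hi j (Finset.mem_univ j))
  obtain ⟨u, rfl, hu⟩ := exists_pos_of_partSum_pos hipos
  obtain ⟨v, rfl, hv⟩ := exists_pos_of_partSum_pos hjpos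
  have hle := edgeVector_le (fun h => hji (by rw [h])) hu hv
  obtain ⟨w, rfl⟩ := exists_add_of_le hle
  refine ⟨u, v, hji.symm, w, ⟨?_, fun x => ?_⟩, rfl⟩
  · simp only [Pi.add_apply, Finset.sum_add_distrib, sum_edgeVector] at hsum
    omega
  · have hx := partSum_add π (edgeVector u v) w x
    rw [partSum_edgeVector] at hx
    have hpx := hpart x
    by_cases hxu : π u = x
    · rw [if_pos hxu] at hx; omega
    by_cases hxv : π v = x
    · rw [if_pos hxv] at hx; omega
    -- A third part of sum `m + 1` would give a total of at least `3 * (m + 1)`.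
    have h1 := hj x (Finset.mem_erase.2 ⟨Ne.symm hxu, Finset.mem_univ x⟩)
    have h2 := hi (π v) (Finset.mem_univ _)
    have hsplit2 := Finset.add_sum_erase _ (partSum π (edgeVector u v + w)) hjm
    have h3 := Finset.single_le_sum (f := partSum π (edgeVector u v + w)) (fun _ _ => Nat.zero_le _)
      (show x ∈ (Finset.univ.erase (π u)).erase (π v) by simp [Ne.symm hxu, Ne.symm hxv])
    simp only [hxu, hxv, if_false] at hx
    omega

/-- A strict lattice point minus any edge vector lies in the previous dilate. -/
lemma sub_edgeVector_mem_dilateLatticePoints [DecidableEq V] {π : V → ι} {m : ℕ} {z : V → ℕ}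
    (hz : z ∈ strictLatticePoints π (m + 1)) {u v : V} (huv : π u ≠ π v) :
    ∃ w ∈ dilateLatticePoints π m, z = edgeVector u v + w := by
  obtain ⟨hsum, hpos, hpart⟩ := hz
  obtain ⟨w, rfl⟩ := exists_add_of_le
    (edgeVector_le (fun h => huv (by rw [h])) (hpos u) (hpos v))
  refine ⟨w, ⟨?_, fun x => ?_⟩, rfl⟩
  · simp only [Pi.add_apply, Finset.sum_add_distrib, sum_edgeVector] at hsum
    omega
  · have hx := partSum_add π (edgeVector u v) w x
    have hpx := hpart x
    omega

lemma edgeVector_add_mem_dilateLatticePoints [DecidableEq V] {π : V → ι} {m : ℕ} {w : V → ℕ}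
    (hw : w ∈ dilateLatticePoints π m) {u v : V} (huv : π u ≠ π v) :
    edgeVector u v + w ∈ dilateLatticePoints π (m + 1) := by
  obtain ⟨hsum, hpart⟩ := hw
  refine ⟨?_, fun i => ?_⟩
  · simp only [Pi.add_apply, Finset.sum_add_distrib, sum_edgeVector, hsum]; ring
  · rw [partSum_add, partSum_edgeVector]
    have := hpart i
    split_ifs with h1 h2
    · exact absurd (h1.trans h2.symm) huv
    all_goals omega

lemma add_mem_dilateLatticePoints {π : V → ι} {m n : ℕ} {z w : V → ℕ}
    (hz : z ∈ dilateLatticePoints π m) (hw : w ∈ dilateLatticePoints π n) :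
    z + w ∈ dilateLatticePoints π (m + n) := by
  refine ⟨?_, fun i => ?_⟩
  · simp only [Pi.add_apply, Finset.sum_add_distrib, hz.1, hw.1]; ring
  · rw [partSum_add]; exact add_le_add (hz.2 i) (hw.2 i)

lemma zero_mem_dilateLatticePoints (π : V → ι) : (0 : V → ℕ) ∈ dilateLatticePoints π 0 := by
  simp [dilateLatticePoints, partSum]

end PartSum

/-! ### Graded pieces of the edge ring -/

section EdgeRing

open MvPolynomial

variable (k : Type*) [Field k] {V ι : Type*} [Fintype V] [Fintype ι] [DecidableEq ι]

lemma monomial_edgeVector [DecidableEq V] (u v : V) :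
    monomial (Finsupp.equivFunOnFinite.symm (edgeVector u v)) (1 : k) = X u * X v := by
  rw [X, X, monomial_mul, one_mul]
  refine congrArg (fun s => monomial s (1 : k)) ?_
  ext x
  simp [edgeVector, Finsupp.single_eq_pi_single]

lemma monomial_mem_edgeRing {G : SimpleGraph V} {π : V → ι} (hG : ∀ u v, G.Adj u v ↔ π u ≠ π v)
    {m : ℕ} {z : V → ℕ} (hz : z ∈ dilateLatticePoints π m) :
    monomial (Finsupp.equivFunOnFinite.symm z) (1 : k) ∈ G.edgeRing k := by
  classical
  induction m generalizing z with
  | zero =>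
    have : Finsupp.equivFunOnFinite.symm z = 0 := by
      ext v
      have := hz.1
      simp only [mul_zero, Finset.sum_eq_zero_iff] at this
      simpa using this v (Finset.mem_univ v)
    rw [this]
    exact one_mem _
  | succ m ih =>
    obtain ⟨u, v, huv, w, hw, rfl⟩ := exists_edgeVector_add_of_mem_dilateLatticePoints hz
    have e : monomial (Finsupp.equivFunOnFinite.symm (edgeVector u v + w)) (1 : k)
        = (X u * X v) * monomial (Finsupp.equivFunOnFinite.symm w) 1 := by
      rw [← monomial_edgeVector, monomial_mul, one_mul]
      refine congrArg (fun s => monomial s (1 : k)) ?_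
      ext x
      simp
    rw [e]
    exact mul_mem (Algebra.subset_adjoin ⟨u, v, (hG u v).2 huv, rfl⟩) (ih hw)

/-- The edge ring is spanned by the monomials whose exponents lie in some dilate. -/
lemma edgeRing_toSubmodule {G : SimpleGraph V} {π : V → ι} (hG : ∀ u v, G.Adj u v ↔ π u ≠ π v) :
    Subalgebra.toSubmodule (G.edgeRing k) =
      restrictSupport k {s | ∃ m, ⇑s ∈ dilateLatticePoints π m} := by
  classical
  apply le_antisymm
  · intro p hp
    rw [Subalgebra.mem_toSubmodule] at hp
    induction hp using Algebra.adjoin_induction with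
    | mem x hx =>
      obtain ⟨u, v, huv, rfl⟩ := hx
      rw [← monomial_edgeVector]
      refine (monomial_mem_restrictSupport k).2 (Or.inl ⟨1, ?_⟩)
      have := edgeVector_add_mem_dilateLatticePoints (zero_mem_dilateLatticePoints π)
        ((hG u v).1 huv)
      simpa using this
    | algebraMap r =>
      exact (monomial_mem_restrictSupport k).2 (Or.inl ⟨0, zero_mem_dilateLatticePoints π⟩)
    | add x y _ _ hx hy => exact add_mem hx hy
    | mul x y _ _ hx hy =>
      rw [mem_restrictSupport_iff] at hx hy ⊢
      intro s hs
      obtain ⟨a, ha, b, hb, rfl⟩ := Finset.mem_add.1 (support_mul x y hs)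
      obtain ⟨m, hm⟩ := hx ha
      obtain ⟨n, hn⟩ := hy hb
      exact ⟨m + n, add_mem_dilateLatticePoints hm hn⟩
  · rw [restrictSupport_eq_span, Submodule.span_le]
    rintro _ ⟨s, ⟨m, hm⟩, rfl⟩
    have := monomial_mem_edgeRing k hG hm
    simpa using this

/-- The monomials with exponents in the `m`-th dilate form a basis of the `m`-th graded piece of
the edge ring of a complete multipartite graph. -/
theorem finrank_edgeRingPiece {G : SimpleGraph V} {π : V → ι}
    (hG : ∀ u v, G.Adj u v ↔ π u ≠ π v) (m : ℕ) :
    Module.finrank k (G.edgeRingPiece k m) = (dilateLatticePoints π m).ncard := by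
  have h : G.edgeRingPiece k m = restrictSupport k {s | ⇑s ∈ dilateLatticePoints π m} := by
    rw [SimpleGraph.edgeRingPiece, edgeRing_toSubmodule k hG,
      homogeneousSubmodule_eq_finsupp_supported]
    ext p
    simp only [Submodule.mem_inf]
    change p ∈ restrictSupport k _ ∧ p ∈ restrictSupport k _ ↔ _
    rw [mem_restrictSupport_iff, mem_restrictSupport_iff, mem_restrictSupport_iff,
      ← Set.subset_inter_iff]
    suffices ({s : V →₀ ℕ | ∃ m, ⇑s ∈ dilateLatticePoints π m} ∩ {s | s.degree = 2 * m})
        = {s : V →₀ ℕ | ⇑s ∈ dilateLatticePoints π m} by rw [this]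
    ext s
    simp only [Set.mem_inter_iff, Set.mem_ofPred_eq, Finsupp.degree_eq_sum]
    constructor
    · rintro ⟨⟨n, hn⟩, h2⟩
      have := hn.1
      obtain rfl : n = m := by omega
      exact hn
    · intro hs
      exact ⟨⟨m, hs⟩, hs.1⟩
  rw [h, Module.finrank_eq_nat_card_basis (basisRestrictSupport k _), ← Nat.card_coe_set_eq]
  exact Nat.card_congr (Finsupp.equivFunOnFinite.subtypeEquiv fun s => Iff.rfl)

end EdgeRing

/-! ### Krull dimension of the edge ring -/

section KrullDim

/-- An injective integral ring extension preserves Krull dimension. -/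
theorem ringKrullDim_eq_of_injective_of_isIntegral (R S : Type*) [CommRing R] [CommRing S]
    [Algebra R S] [Algebra.IsIntegral R S] [FaithfulSMul R S] :
    ringKrullDim S = ringKrullDim R := by
  apply le_antisymm
  · exact Order.krullDim_le_of_strictMono (PrimeSpectrum.comap (algebraMap R S))
      fun I J h => Ideal.IsIntegral.comap_lt_comap (R := R) (I := I.asIdeal) (J := J.asIdeal) h
  · refine iSup_le fun l => ?_
    obtain ⟨⟨P, hP, hlo⟩⟩ := Ideal.nonempty_primesOver (S := S) (RelSeries.head l).asIdeal
    obtain ⟨L, hL, -⟩ := Ideal.exists_ltSeries_of_hasGoingUp (S := S) l P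
    rw [← hL]
    exact Order.LTSeries.length_le_krullDim L

open MvPolynomial in
/-- A finitely generated domain over a field whose transcendence degree is `d` has Krull
dimension `d`, by Noether normalization. -/
theorem ringKrullDim_eq_of_trdeg_eq (k R : Type*) [Field k] [CommRing R] [IsDomain R]
    [Algebra k R] [Algebra.FiniteType k R] (d : ℕ) (hd : Algebra.trdeg k R = d) :
    ringKrullDim R = (d : WithBot ℕ∞) := by
  obtain ⟨s, g, hinj, hfin⟩ := exists_finite_inj_algHom_of_fg k R
  let := g.toRingHom.toAlgebra
  have : IsScalarTower k (MvPolynomial (Fin s) k) R :=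
    IsScalarTower.of_algebraMap_eq' g.comp_algebraMap.symm
  have : Module.Finite (MvPolynomial (Fin s) k) R := hfin
  have : FaithfulSMul (MvPolynomial (Fin s) k) R :=
    (faithfulSMul_iff_algebraMap_injective _ _).2 hinj
  have htr := lift_trdeg_add_eq k (MvPolynomial (Fin s) k) R
  rw [hd, trdeg_eq_zero (R := MvPolynomial (Fin s) k), MvPolynomial.trdeg_of_isDomain] at htr
  have hsd : s = d := by simpa using htr
  rw [ringKrullDim_eq_of_injective_of_isIntegral (MvPolynomial (Fin s) k) R,
    MvPolynomial.ringKrullDim_of_isNoetherianRing, ringKrullDim_eq_zero_of_field, hsd]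
  simp

variable (k : Type*) [Field k] {V : Type*}

open MvPolynomial

/-- If every vertex lies in a triangle, then the polynomial ring is algebraic over the edge ring:
`t_v ^ 2 = (t_u t_v) (t_v t_w) / (t_u t_w)` for a triangle `u v w`. -/
lemma isAlgebraic_edgeRing {G : SimpleGraph V}
    (htri : ∀ v, ∃ u w, G.Adj u v ∧ G.Adj v w ∧ G.Adj u w) :
    Algebra.IsAlgebraic (G.edgeRing k) (MvPolynomial V k) := by
  refine ⟨fun p => ?_⟩
  induction p using MvPolynomial.induction_on with
  | C a => exact isAlgebraic_algebraMap (algebraMap k (G.edgeRing k) a)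
  | add p q hp hq => exact hp.add hq
  | mul_X p v hp =>
    refine hp.mul ?_
    obtain ⟨u, w, huv, hvw, huw⟩ := htri v
    have hmem {a b : V} (h : G.Adj a b) : (X a * X b : MvPolynomial V k) ∈ G.edgeRing k :=
      Algebra.subset_adjoin ⟨a, b, h, rfl⟩
    refine ⟨Polynomial.C ⟨_, hmem huw⟩ * Polynomial.X ^ 2
      - Polynomial.C (⟨_, hmem huv⟩ * ⟨_, hmem hvw⟩), fun h => ?_, ?_⟩
    · have h2 := congrArg (fun q => Polynomial.coeff q 2) h
      simp only [Polynomial.coeff_sub, Polynomial.coeff_C_mul_X_pow, Polynomial.coeff_C,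
        if_true, Polynomial.coeff_zero] at h2
      have h3 := congrArg Subtype.val h2
      simp at h3
    · simp only [map_sub, map_mul, Polynomial.aeval_C, map_pow, Polynomial.aeval_X]
      change (X u * X w) * X v ^ 2 - (X u * X v) * (X v * X w) = _
      ring

theorem ringKrullDim_edgeRing [Fintype V] {G : SimpleGraph V}
    (htri : ∀ v, ∃ u w, G.Adj u v ∧ G.Adj v w ∧ G.Adj u w) :
    ringKrullDim (G.edgeRing k) = ((Fintype.card V : ℕ) : WithBot ℕ∞) := by
  have := isAlgebraic_edgeRing k htri
  have : Algebra.FiniteType k (G.edgeRing k) := by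
    refine (Subalgebra.fg_iff_finiteType _).1 (Subalgebra.fg_def.2 ⟨_, ?_, rfl⟩)
    refine (Set.finite_range fun e : V × V => (X e.1 * X e.2 : MvPolynomial V k)).subset ?_
    rintro _ ⟨u, v, -, rfl⟩
    exact ⟨(u, v), rfl⟩
  have htr := trdeg_add_eq k (G.edgeRing k) (A := MvPolynomial V k)
  rw [trdeg_eq_zero (R := G.edgeRing k), MvPolynomial.trdeg_of_isDomain, add_zero] at htr
  exact ringKrullDim_eq_of_trdeg_eq k _ _ (by rw [htr]; simp)

end KrullDim

/-! ### Counting lattice points -/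

section Count

open Finset

/-- The vectors of natural numbers indexed by `α` with all entries at least `b` and sum `n`. -/
def boundedCompositions (α : Type*) [Fintype α] (b n : ℕ) : Set (α → ℕ) :=
  {z | ∑ v, z v = n ∧ ∀ v, b ≤ z v}

lemma finite_boundedCompositions (α : Type*) [Fintype α] (b n : ℕ) :
    (boundedCompositions α b n).Finite := by
  classical
  refine (piAntidiag univ n).finite_toSet.subset fun z hz => ?_
  simpa using hz.1

lemma ncard_boundedCompositions_zero (α : Type*) [Fintype α] (a n : ℕ)
    (ha : Fintype.card α = a + 1) :
    (boundedCompositions α 0 n).ncard = (n + a).choose a := by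
  classical
  have h : boundedCompositions α 0 n = ((piAntidiag univ n : Finset (α → ℕ)) : Set (α → ℕ)) := by
    ext z; simp [boundedCompositions]
  have e : #(piAntidiag univ n : Finset (α → ℕ)) = #(finsuppAntidiag univ n : Finset (α →₀ ℕ)) := by
    refine card_bij' (fun z _ => Finsupp.equivFunOnFinite.symm z) (fun z _ => ⇑z) ?_ ?_ ?_ ?_ <;>
      simp
  rw [h, Set.ncard_coe_finset, e, card_finsuppAntidiag_nat_eq_choose, card_univ, ha,
    show a + 1 + n - 1 = n + a by omega, Nat.choose_symm_add]

lemma ncard_boundedCompositions_one (α : Type*) [Fintype α] (a n : ℕ)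
    (ha : Fintype.card α = a + 1) :
    (boundedCompositions α 1 (n + 1)).ncard = n.choose a := by
  rcases lt_or_ge n a with hn | hn
  · rw [Nat.choose_eq_zero_of_lt hn, Set.ncard_eq_zero (finite_boundedCompositions _ _ _),
      Set.eq_empty_iff_forall_notMem]
    rintro z ⟨h1, h2⟩
    have : ∑ _v : α, 1 ≤ ∑ v, z v := sum_le_sum fun v _ => h2 v
    simp [ha] at this
    omega
  · obtain ⟨c, rfl⟩ := Nat.exists_eq_add_of_le hn
    have h : boundedCompositions α 1 (a + c + 1) = (fun z => z + 1) '' boundedCompositions α 0 c := by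
      ext z
      constructor
      · rintro ⟨h1, h2⟩
        have e : (z - 1) + 1 = z := by
          ext v
          simpa using Nat.sub_add_cancel (h2 v)
        refine ⟨z - 1, ⟨?_, fun v => Nat.zero_le _⟩, e⟩
        rw [← e] at h1
        simp only [Pi.add_apply, sum_add_distrib, Pi.one_apply, sum_const, card_univ, ha] at h1
        simp only [smul_eq_mul, mul_one] at h1
        omega
      · rintro ⟨w, ⟨h1, -⟩, rfl⟩
        refine ⟨?_, fun v => by simp⟩
        simp [sum_add_distrib, h1, ha]
        omega
    rw [h, Set.ncard_image_of_injective _ (add_left_injective _),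
      ncard_boundedCompositions_zero α a c ha, add_comm c]

lemma ncard_biUnion_finset_of_disjoint {α β : Type*} (t : Finset α) (s : α → Set β)
    (hfin : ∀ i ∈ t, (s i).Finite) (hdisj : (t : Set α).PairwiseDisjoint s) :
    (⋃ i ∈ t, s i).ncard = ∑ i ∈ t, (s i).ncard := by
  rw [← finsum_mem_coe_finset, ← t.finite_toSet.ncard_biUnion hfin hdisj]
  simp

variable {V ι : Type*} [Fintype V] [DecidableEq ι]

lemma ncard_boundedCompositions_partSum_eq (π : V → ι) (i : ι) (b x y : ℕ) :
    {z | z ∈ boundedCompositions V b (x + y) ∧ partSum π z i = x}.ncard =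
      (boundedCompositions {v // π v = i} b x).ncard *
        (boundedCompositions {v // ¬ π v = i} b y).ncard := by
  have hsub (z : V → ℕ) : partSum π z i = ∑ v : {v // π v = i}, z v := by
    rw [partSum]
    exact (Finset.sum_subtype _ (by simp) _)
  have hall (z : V → ℕ) : ∑ v, z v = ∑ v : {v // π v = i}, z v + ∑ v : {v // ¬ π v = i}, z v :=
    (Fintype.sum_subtype_add_sum_subtype (fun v => π v = i) z).symm
  rw [← Nat.card_coe_set_eq, ← Nat.card_coe_set_eq, ← Nat.card_coe_set_eq, ← Nat.card_prod]
  refine Nat.card_congr (((Equiv.piEquivPiSubtypeProd (fun v => π v = i) fun _ => ℕ).subtypeEquiv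
    fun z => ?_).trans (Equiv.Set.prod _ _))
  change (_ ∧ _) ∧ _ ↔ (_ ∧ _) ∧ (_ ∧ _)
  simp only [Equiv.piEquivPiSubtypeProd_apply, hsub, hall]
  constructor
  · rintro ⟨⟨h1, h2⟩, h3⟩
    exact ⟨⟨h3, fun v => h2 v⟩, by omega, fun v => h2 v⟩
  · rintro ⟨⟨h1, h2⟩, h3, h4⟩
    refine ⟨⟨by omega, fun v => ?_⟩, h1⟩
    by_cases hv : π v = i
    · exact h2 ⟨v, hv⟩
    · exact h4 ⟨v, hv⟩

/-- The vectors violating the inequality for the part `i`, sorted by the sum `c + b` of their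
entries outside that part. -/
lemma ncard_lt_partSum_add (π : V → ι) (i : ι) (b m : ℕ) (hb : b ≤ 1)
    (hne : ∃ v, π v ≠ i) :
    {z | z ∈ boundedCompositions V b (2 * m) ∧ m < partSum π z i + b}.ncard =
      ∑ c ∈ range m, (boundedCompositions {v // π v = i} b (2 * m - c - b)).ncard *
        (boundedCompositions {v // ¬ π v = i} b (c + b)).ncard := by
  classical
  have hfin := finite_boundedCompositions V b (2 * m)
  have hset : {z | z ∈ boundedCompositions V b (2 * m) ∧ m < partSum π z i + b} =
      ⋃ c ∈ range m, {z | z ∈ boundedCompositions V b (2 * m) ∧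
        partSum π z i = 2 * m - c - b} := by
    ext z
    simp only [Set.mem_ofPred_eq, Set.mem_iUnion, mem_range, exists_prop]
    constructor
    · rintro ⟨hz, h⟩
      have hle : partSum π z i + b ≤ 2 * m := by
        obtain ⟨v, hv⟩ := hne
        have h1 := hz.2 v
        have h2 : partSum π z i + z v ≤ ∑ v, z v := by
          rw [partSum, add_comm, ← sum_insert (by simpa using hv)]
          exact sum_le_sum_of_subset (subset_univ _)
        have := hz.1
        omega
      exact ⟨2 * m - b - partSum π z i, by omega, hz, by omega⟩
    · rintro ⟨c, hc, hz, h⟩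
      exact ⟨hz, by omega⟩
  rw [hset, ncard_biUnion_finset_of_disjoint]
  · refine sum_congr rfl fun c hc => ?_
    have hc' := mem_range.1 hc
    rw [← ncard_boundedCompositions_partSum_eq]
    congr 2
    ext z
    rw [show 2 * m - c - b + (c + b) = 2 * m by omega]
  · exact fun c _ => hfin.subset fun z hz => hz.1
  · intro c hc c' hc' hcc
    refine Set.disjoint_left.2 fun z hz hz' => hcc ?_
    have h1 := hz.2
    have h2 := hz'.2
    have := mem_range.1 (mem_coe.1 hc)
    have := mem_range.1 (mem_coe.1 hc')
    omega

/-- Inclusion-exclusion: at most one of the part inequalities can fail, so that the vectors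
satisfying all of them are counted by subtracting, for each part, those violating it. -/
lemma ncard_forall_partSum_add_le [Fintype ι] (π : V → ι) (b m : ℕ)
    (hdisj : ∀ z ∈ boundedCompositions V b (2 * m), ∀ i j, i ≠ j →
      m < partSum π z i + b → ¬ m < partSum π z j + b) :
    {z | z ∈ boundedCompositions V b (2 * m) ∧ ∀ i, partSum π z i + b ≤ m}.ncard +
      ∑ i, {z | z ∈ boundedCompositions V b (2 * m) ∧ m < partSum π z i + b}.ncard =
      (boundedCompositions V b (2 * m)).ncard := by
  have hfin := finite_boundedCompositions V b (2 * m)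
  have hbad : (⋃ i ∈ (univ : Finset ι),
      {z | z ∈ boundedCompositions V b (2 * m) ∧ m < partSum π z i + b}).Finite := by
    refine hfin.subset fun z hz => ?_
    simp only [Set.mem_iUnion] at hz
    obtain ⟨i, -, hi⟩ := hz
    exact hi.1
  rw [← ncard_biUnion_finset_of_disjoint _ _ (fun i _ => hfin.subset fun z hz => hz.1)
      fun i _ j _ hij =>
        Set.disjoint_left.2 fun z hz hz' => hdisj z hz.1 i j hij hz.2 hz'.2,
    ← Set.ncard_union_eq ?_ (hfin.subset fun z hz => hz.1) hbad]
  · congr 1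
    ext z
    simp only [Set.mem_union, Set.mem_ofPred_eq, Set.mem_iUnion, mem_univ, exists_prop, true_and]
    constructor
    · rintro (h | ⟨i, h⟩)
      exacts [h.1, h.1]
    · intro h
      by_cases h2 : ∀ i, partSum π z i + b ≤ m
      · exact Or.inl ⟨h, h2⟩
      · push Not at h2
        obtain ⟨i, hi⟩ := h2
        exact Or.inr ⟨i, h, hi⟩
  · refine Set.disjoint_left.2 fun z hz hz' => ?_
    simp only [Set.mem_iUnion] at hz'
    obtain ⟨i, -, hi⟩ := hz'
    exact absurd (hz.2 i) (not_le.2 hi.2)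

lemma partSum_add_partSum_le [Fintype ι] (π : V → ι) (z : V → ℕ) {i j : ι} (hij : i ≠ j) :
    partSum π z i + partSum π z j ≤ ∑ v, z v := by
  rw [← sum_partSum π z, ← sum_pair hij]
  exact sum_le_sum_of_subset (subset_univ _)

/-- With at least three parts, a positive vector has two parts of sum less than its total. -/
lemma partSum_add_partSum_lt [Fintype ι] (π : V → ι) (hπ : Function.Surjective π) (z : V → ℕ)
    (hz : ∀ v, 0 < z v) (hι : 2 < Fintype.card ι) {i j : ι} (hij : i ≠ j) :
    partSum π z i + partSum π z j < ∑ v, z v := by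
  obtain ⟨v, hx⟩ := exists_apply_notMem_of_card_le_two hπ hι {i, j} card_le_two
  have hv : z v ≤ partSum π z (π v) :=
    single_le_sum (f := z) (fun _ _ => Nat.zero_le _) (by simp)
  have h1 : partSum π z (π v) + (partSum π z i + partSum π z j) ≤ ∑ v, z v := by
    rw [← sum_partSum π z, ← sum_pair hij, ← sum_insert hx]
    exact sum_le_sum_of_subset (subset_univ _)
  have := hz v
  omega

/-- Both the number of lattice points in the `m`-th dilate and, up to sign, the number of those
with strict inequalities are values of the same polynomial, at `m` and at `-m`. -/
theorem exists_ehrhart_polynomial [Fintype ι] (π : V → ι) (hπ : Function.Surjective π)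
    (hι : 2 < Fintype.card ι) :
    ∃ p : Polynomial ℚ, p.natDegree < Fintype.card V ∧
      (∀ m : ℕ, p.eval (m : ℚ) = ((dilateLatticePoints π m).ncard : ℤ)) ∧
      ∀ m : ℕ, 0 < m → p.eval (-(m : ℚ)) =
        (-1) ^ (Fintype.card V - 1) * ((strictLatticePoints π m).ncard : ℤ) := by
  classical
  have hne (i : ι) : ∃ v, π v ≠ i := by
    have : Nontrivial ι := Fintype.one_lt_card_iff_nontrivial.1 (by omega)
    obtain ⟨j, hj⟩ := exists_ne i
    obtain ⟨v, rfl⟩ := hπ j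
    exact ⟨v, hj⟩
  -- The two blocks of coordinates for the part `i` have `a i + 1` and `q i + 1` elements.
  have hblock (i : ι) : ∃ a q, Fintype.card {v // π v = i} = a + 1 ∧
      Fintype.card {v // ¬ π v = i} = q + 1 ∧ Fintype.card V = a + q + 2 := by
    have h1 : 0 < Fintype.card {v // π v = i} := by
      obtain ⟨v, hv⟩ := hπ i
      exact Fintype.card_pos_iff.2 ⟨⟨v, hv⟩⟩
    have h2 : 0 < Fintype.card {v // ¬ π v = i} := by
      obtain ⟨v, hv⟩ := hne i
      exact Fintype.card_pos_iff.2 ⟨⟨v, hv⟩⟩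
    have h3 := Fintype.card_subtype_compl (fun v => π v = i)
    have h4 := Fintype.card_subtype_le (fun v => π v = i)
    exact ⟨_, _, (Nat.succ_pred_eq_of_pos h1).symm, (Nat.succ_pred_eq_of_pos h2).symm, by
      simp only [Nat.pred_eq_sub_one] at *; omega⟩
  choose a q ha hq hcard using hblock
  choose P hPdeg hPpos hPneg using fun i => exists_polynomial_sum_choose_mul_choose (a i) (q i)
  obtain ⟨i₀⟩ : Nonempty ι := Fintype.card_pos_iff.1 (by omega)
  obtain ⟨e, he⟩ : ∃ e, Fintype.card V = e + 1 := ⟨_, hcard i₀⟩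
  have hae (i : ι) : a i + q i + 1 = e := by have := hcard i; omega
  have hdil (m : ℕ) : (dilateLatticePoints π m).ncard
      + ∑ i, ∑ c ∈ range m, (2 * m - c + a i).choose (a i) * (c + q i).choose (q i)
      = (2 * m + e).choose e := by
    have h := ncard_forall_partSum_add_le π 0 m fun z hz i j hij h1 h2 => by
      have := partSum_add_partSum_le π z hij
      have := hz.1
      omega
    rw [ncard_boundedCompositions_zero V e _ he] at h
    rw [← h]
    congr 1
    · congr 1
      ext z
      simp [dilateLatticePoints, boundedCompositions]
    · refine sum_congr rfl fun i _ => ?_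
      rw [ncard_lt_partSum_add π i 0 m (by omega) (hne i)]
      refine sum_congr rfl fun c _ => ?_
      rw [ncard_boundedCompositions_zero _ _ _ (ha i), ncard_boundedCompositions_zero _ _ _ (hq i)]
      rfl
  have hstrict (m : ℕ) (hm : 0 < m) : (strictLatticePoints π m).ncard
      + ∑ i, ∑ c ∈ range m, (2 * m - c - 2).choose (a i) * c.choose (q i)
      = (2 * m - 1).choose e := by
    have h := ncard_forall_partSum_add_le π 1 m fun z hz i j hij h1 h2 => by
      have := partSum_add_partSum_lt π hπ z hz.2 hι hij
      have := hz.1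
      omega
    have h2m : 2 * m = (2 * m - 1) + 1 := by omega
    have h2 : (boundedCompositions V 1 (2 * m)).ncard = (2 * m - 1).choose e := by
      rw [h2m, ncard_boundedCompositions_one V e _ he]; rfl
    rw [h2] at h
    rw [← h]
    congr 1
    · congr 1
      ext z
      simp only [strictLatticePoints, boundedCompositions, Set.mem_ofPred_eq, and_assoc,
        Nat.succ_le_iff]
    · refine sum_congr rfl fun i _ => ?_
      rw [ncard_lt_partSum_add π i 1 m le_rfl (hne i)]
      refine sum_congr rfl fun c hc => ?_
      have hc' := mem_range.1 hc
      rw [show 2 * m - c - 1 = (2 * m - c - 2) + 1 by omega,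
        ncard_boundedCompositions_one _ _ _ (ha i), ncard_boundedCompositions_one _ _ _ (hq i)]
  refine ⟨(Polynomial.preHilbertPoly ℚ e 0).comp (Polynomial.C 2 * Polynomial.X) - ∑ i, P i,
    ?_, fun m => ?_, fun m hm => ?_⟩
  · rw [he, Nat.lt_succ_iff]
    refine (Polynomial.natDegree_sub_le _ _).trans (max_le ?_ ?_)
    · refine Polynomial.natDegree_comp_le.trans ?_
      rw [Polynomial.natDegree_preHilbertPoly]
      have := Polynomial.natDegree_C_mul_le (2 : ℚ) Polynomial.X
      rw [Polynomial.natDegree_X] at this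
      nlinarith
    · exact Polynomial.natDegree_sum_le_of_forall_le _ _ fun i _ => by
        have := hPdeg i
        have := hae i
        omega
  · have h := hdil m
    simp only [Polynomial.eval_sub, Polynomial.eval_comp, Polynomial.eval_mul, Polynomial.eval_C,
      Polynomial.eval_X, Polynomial.eval_finsetSum, hPpos]
    rw [show (2 : ℚ) * m = ((2 * m : ℕ) : ℚ) by push_cast; rfl, eval_preHilbertPoly_natCast, ← h]
    push_cast
    ring
  · have h := hstrict m hm
    simp only [Polynomial.eval_sub, Polynomial.eval_comp, Polynomial.eval_mul, Polynomial.eval_C,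
      Polynomial.eval_X, Polynomial.eval_finsetSum, hPneg, hae]
    rw [show (2 : ℚ) * -m = -(((2 * m - 1 : ℕ) : ℚ) + 1) by
        rw [Nat.cast_sub (by omega)]; push_cast; ring,
      eval_preHilbertPoly_neg, ← h, he, Nat.add_sub_cancel, ← mul_sum]
    push_cast
    ring

end Count

/-! ### Intrinsic interior of a convex hull -/

section IntrinsicInterior

variable {E : Type*} [NormedAddCommGroup E] [NormedSpace ℝ E]

/-- A segment ending in a point of the intrinsic interior can be prolonged inside the set. -/
lemma exists_add_smul_sub_mem_of_mem_intrinsicInterior {P : Set E} {x y : E}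
    (hx : x ∈ intrinsicInterior ℝ P) (hy : y ∈ P) : ∃ t : ℝ, 0 < t ∧ x + t • (x - y) ∈ P := by
  obtain ⟨x', hx', rfl⟩ := hx
  let φ : ℝ → affineSpan ℝ P := fun t => ⟨AffineMap.lineMap (x' : E) y (-t),
    AffineMap.lineMap_mem _ x'.2 (subset_affineSpan ℝ P hy)⟩
  have hφ : Continuous φ := by
    refine Continuous.subtype_mk ?_ _
    simp only [AffineMap.lineMap_apply_module]
    fun_prop
  have h0 : φ 0 ∈ interior ((↑) ⁻¹' P : Set (affineSpan ℝ P)) := by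
    have : φ 0 = x' := by ext; simp [φ]
    rwa [this]
  have hnhds := (hφ.continuousAt (x := 0)).preimage_mem_nhds (isOpen_interior.mem_nhds h0)
  obtain ⟨ε, hε, hball⟩ := Metric.mem_nhds_iff.1 hnhds
  refine ⟨ε / 2, by positivity, ?_⟩
  have hmem : ε / 2 ∈ Metric.ball (0 : ℝ) ε := by
    rw [Metric.mem_ball, Real.dist_eq, sub_zero, abs_of_pos (by positivity)]; linarith
  have h := interior_subset (hball hmem)
  have e : (φ (ε / 2) : E) = x' + (ε / 2) • ((x' : E) - y) := by
    simp only [φ, AffineMap.lineMap_apply_module]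
    module
  rw [← e]
  exact h

/-- A point of a convex set from which every segment of the set can be prolonged lies in the
intrinsic interior. -/
lemma mem_intrinsicInterior_of_forall_exists [FiniteDimensional ℝ E] {P : Set E}
    (hP : Convex ℝ P) (hne : P.Nonempty) {x : E}
    (hx : ∀ p ∈ P, ∃ t : ℝ, 0 < t ∧ x + t • (x - p) ∈ P) : x ∈ intrinsicInterior ℝ P := by
  obtain ⟨_, p, hp, rfl⟩ := hne.intrinsicInterior hP
  have hpP : (p : E) ∈ P := interior_subset (s := ((↑) ⁻¹' P : Set (affineSpan ℝ P))) hp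
  obtain ⟨t, ht, hy⟩ := hx p hpP
  set y := x + t • (x - (p : E)) with hydef
  have hyspan := subset_affineSpan ℝ P hy
  have hc0 : (0 : ℝ) < (1 + t) / t := by positivity
  have hc1 : ((1 + t) / t)⁻¹ ≤ 1 := by
    rw [inv_div, div_le_one (by positivity)]; linarith
  have hback (q : E) (hq : AffineMap.lineMap y q ((1 + t) / t) ∈ P) : q ∈ P := by
    have e : q = AffineMap.lineMap y (AffineMap.lineMap y q ((1 + t) / t) : E)
        ((1 + t) / t)⁻¹ := by
      simp only [AffineMap.lineMap_apply, vadd_eq_add, vsub_eq_sub, add_sub_cancel_right, smul_smul,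
        inv_mul_cancel₀ hc0.ne', one_smul, sub_add_cancel]
    rw [e]
    exact hP.lineMap_mem hy hq ⟨by positivity, hc1⟩
  have hxp : AffineMap.lineMap y x ((1 + t) / t) = (p : E) := by
    have e : y - x = t • (x - p) := by rw [hydef]; abel
    have e2 : (AffineMap.lineMap y x ((1 + t) / t) : E)
        = y - ((1 + t) / t) • (y - x) := by
      rw [AffineMap.lineMap_apply_module]; module
    rw [e2, e, smul_smul, div_mul_cancel₀ _ ht.ne', hydef]
    module
  have hxP : x ∈ P := hback x (hxp ▸ hpP)
  let φ : affineSpan ℝ P → affineSpan ℝ P := fun q =>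
    ⟨AffineMap.lineMap y (q : E) ((1 + t) / t), AffineMap.lineMap_mem _ hyspan q.2⟩
  have hφ : Continuous φ := by
    refine Continuous.subtype_mk ?_ _
    simp only [AffineMap.lineMap_apply_module]
    fun_prop
  refine ⟨⟨x, subset_affineSpan ℝ P hxP⟩, ?_, rfl⟩
  refine mem_interior.2 ⟨φ ⁻¹' interior ((↑) ⁻¹' P), fun q hq => hback q ?_,
    isOpen_interior.preimage hφ, ?_⟩
  · exact interior_subset (s := ((↑) ⁻¹' P : Set (affineSpan ℝ P))) hq
  · have : φ ⟨x, subset_affineSpan ℝ P hxP⟩ = p := Subtype.ext hxp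
    rw [Set.mem_preimage, this]
    exact hp

/-- To prolong all segments from `x` inside a convex hull, it is enough to do so for the segments
from the generating points. -/
lemma mem_intrinsicInterior_convexHull [FiniteDimensional ℝ E] {s : Set E} (hne : s.Nonempty)
    {x : E} (hxs : x ∈ convexHull ℝ s)
    (hx : ∀ p ∈ s, ∃ t : ℝ, 0 < t ∧ x + t • (x - p) ∈ convexHull ℝ s) :
    x ∈ intrinsicInterior ℝ (convexHull ℝ s) := by
  have hconv := convex_convexHull ℝ s
  refine mem_intrinsicInterior_of_forall_exists hconv hne.convexHull ?_
  have hshrink {p : E} {t u : ℝ} (ht : 0 < t) (h : x + t • (x - p) ∈ convexHull ℝ s)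
      (hu : 0 ≤ u) (hut : u ≤ t) : x + u • (x - p) ∈ convexHull ℝ s := by
    have h2 := hconv.lineMap_mem hxs h (t := u / t) ⟨by positivity, (div_le_one ht).2 hut⟩
    rw [AffineMap.lineMap_apply, vsub_eq_sub, add_sub_cancel_left, smul_smul,
      div_mul_cancel₀ _ ht.ne', vadd_eq_add, add_comm] at h2
    exact h2
  suffices hS : Convex ℝ {p | ∃ t : ℝ, 0 < t ∧ x + t • (x - p) ∈ convexHull ℝ s} from
    fun p hp => convexHull_min (fun p hp => hx p hp) hS hp
  rintro p ⟨t, ht, hp⟩ q ⟨u, hu, hq⟩ a b ha hb hab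
  have hm : 0 < min t u := lt_min ht hu
  refine ⟨min t u, hm, ?_⟩
  have h := hconv (hshrink ht hp hm.le (min_le_left _ _)) (hshrink hu hq hm.le (min_le_right _ _))
    ha hb hab
  convert h using 1
  have hb' : b = 1 - a := by linarith
  rw [hb']
  module

end IntrinsicInterior

/-! ### The relative interior of the edge polytope -/

section EdgePolytope

lemma natCast_edgeVector {V : Type*} [DecidableEq V] (u v : V) :
    (fun x => (edgeVector u v x : ℝ)) = Pi.single u 1 + Pi.single v 1 := by
  ext x
  simp [edgeVector, Pi.single_apply]

lemma natCast_edgeVector_mem_edgePolytope {V : Type*} [DecidableEq V] {G : SimpleGraph V} {u v : V}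
    (h : G.Adj u v) : (fun x => (edgeVector u v x : ℝ)) ∈ G.edgePolytope := by
  refine subset_convexHull ℝ _ ⟨u, v, h, ?_⟩
  rw [natCast_edgeVector]
  congr!

variable {V ι : Type*} [Fintype V] [DecidableEq ι]

lemma partSum_natCast (π : V → ι) (z : V → ℕ) (i : ι) :
    partSum π (fun v => (z v : ℝ)) i = ((partSum π z i : ℕ) : ℝ) := by
  simp [partSum]

/-- The inequalities satisfied by the edge polytope of a complete multipartite graph. -/
lemma inequalities_of_mem_edgePolytope {G : SimpleGraph V} {π : V → ι}
    (hG : ∀ u v, G.Adj u v ↔ π u ≠ π v) {x : V → ℝ} (hx : x ∈ G.edgePolytope) :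
    ∑ v, x v = 2 ∧ (∀ v, 0 ≤ x v) ∧ ∀ i, partSum π x i ≤ 1 := by
  classical
  have hQ : Convex ℝ {x : V → ℝ | ∑ v, x v = 2 ∧ (∀ v, 0 ≤ x v) ∧ ∀ i, partSum π x i ≤ 1} := by
    rintro x ⟨h1, h2, h3⟩ y ⟨h4, h5, h6⟩ a b ha hb hab
    refine ⟨?_, fun v => ?_, fun i => ?_⟩
    · simp only [Pi.add_apply, Pi.smul_apply, smul_eq_mul, Finset.sum_add_distrib,
        ← Finset.mul_sum, h1, h4]
      linarith
    · have := h2 v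
      have := h5 v
      simp only [Pi.add_apply, Pi.smul_apply, smul_eq_mul]
      positivity
    · have h7 := mul_le_mul_of_nonneg_left (h3 i) ha
      have h8 := mul_le_mul_of_nonneg_left (h6 i) hb
      rw [partSum_add]
      have e (c : ℝ) (w : V → ℝ) : partSum π (c • w) i = c * partSum π w i := by
        simp [partSum, Finset.mul_sum]
      rw [e, e]
      linarith
  refine convexHull_min ?_ hQ hx
  rintro _ ⟨u, v, huv, rfl⟩
  have huv' := (hG u v).1 huv
  refine ⟨?_, fun w => ?_, fun i => ?_⟩
  · simp [Finset.sum_add_distrib, Finset.sum_pi_single']; norm_num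
  · simp only [Pi.add_apply, Pi.single_apply]
    positivity
  · rw [partSum_add, partSum_single, partSum_single]
    split_ifs with h1 h2
    · exact absurd (h1.trans h2.symm) huv'
    all_goals norm_num

lemma exists_smul_eq_of_mem_dilateLatticePoints [Fintype ι] {G : SimpleGraph V} {π : V → ι}
    (hG : ∀ u v, G.Adj u v ↔ π u ≠ π v) (hne : G.edgePolytope.Nonempty) {m : ℕ} {z : V → ℕ}
    (hz : z ∈ dilateLatticePoints π m) :
    ∃ y ∈ G.edgePolytope, (fun v => (z v : ℝ)) = (m : ℝ) • y := by
  classical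
  induction m generalizing z with
  | zero =>
    obtain ⟨y, hy⟩ := hne
    refine ⟨y, hy, ?_⟩
    ext v
    have := hz.1
    simp only [mul_zero, Finset.sum_eq_zero_iff] at this
    simpa using this v (Finset.mem_univ v)
  | succ m ih =>
    obtain ⟨u, v, huv, w, hw, rfl⟩ := exists_edgeVector_add_of_mem_dilateLatticePoints hz
    obtain ⟨y, hy, hwy⟩ := ih hw
    have he := natCast_edgeVector_mem_edgePolytope ((hG u v).2 huv)
    have hm : (0 : ℝ) < m + 1 := by positivity
    refine ⟨_, convex_convexHull ℝ _ he hy (a := 1 / (m + 1)) (b := m / (m + 1))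
      (by positivity) (by positivity) (by field_simp; ring), ?_⟩
    ext x
    have hx := congrFun hwy x
    simp only [Pi.smul_apply, smul_eq_mul] at hx
    simp only [Pi.add_apply, Pi.smul_apply, smul_eq_mul, Nat.cast_add, hx]
    push_cast
    field_simp

/-- The dilate `m P°` contains a lattice point exactly when the strict inequalities have one. -/
theorem interiorLatticePoints_nonempty_iff [Fintype ι] {G : SimpleGraph V} {π : V → ι}
    (hG : ∀ u v, G.Adj u v ↔ π u ≠ π v) (hπ : Function.Surjective π)
    (hι : 2 < Fintype.card ι) {m : ℕ} (hm : 0 < m) :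
    (G.interiorLatticePoints m).Nonempty ↔ (strictLatticePoints π m).Nonempty := by
  classical
  have hthird := exists_apply_notMem_of_card_le_two hπ hι
  have hmR : (0 : ℝ) < m := by exact_mod_cast hm
  constructor
  · rintro ⟨z, x, hx, hxz⟩
    have hzx (v : V) : (z v : ℝ) = m * x v := (congrFun hxz v).symm
    have hQ := inequalities_of_mem_edgePolytope hG (intrinsicInterior_subset hx)
    have hprolong (y : V → ℝ) (hy : y ∈ G.edgePolytope) : ∃ t : ℝ, 0 < t ∧
        (∀ v, 0 ≤ (x + t • (x - y)) v) ∧ ∀ i, partSum π (x + t • (x - y)) i ≤ 1 := by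
      obtain ⟨t, ht, h⟩ := exists_add_smul_sub_mem_of_mem_intrinsicInterior hx hy
      exact ⟨t, ht, (inequalities_of_mem_edgePolytope hG h).2⟩
    have hxpos (v : V) : 0 < x v := by
      obtain ⟨u, hu⟩ := hthird {π v} (by simp)
      obtain ⟨t, ht, h, -⟩ := hprolong _ (natCast_edgeVector_mem_edgePolytope
        ((hG u v).2 (by simpa using hu)))
      have h1 := h v
      have huv : u ≠ v := fun h => hu (by simp [h])
      simp only [edgeVector, Pi.add_apply, Pi.smul_apply, Pi.sub_apply, Pi.single_apply,
        smul_eq_mul, huv.symm, if_true, if_false] at h1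
      push_cast at h1
      nlinarith
    have hxlt (i : ι) : partSum π x i < 1 := by
      obtain ⟨u, hu⟩ := hthird {i} (by simp)
      obtain ⟨v, hv⟩ := hthird {i, π u} Finset.card_le_two
      simp only [Finset.mem_insert, Finset.mem_singleton, not_or] at hu hv
      obtain ⟨t, ht, -, h⟩ := hprolong _ (natCast_edgeVector_mem_edgePolytope
        ((hG u v).2 (Ne.symm hv.2)))
      have h1 := h i
      have e : partSum π (x + t • (x - fun w => (edgeVector u v w : ℝ))) i
          = partSum π x i + t * (partSum π x i - partSum π (fun w => (edgeVector u v w : ℝ)) i) := by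
        simp only [partSum, Pi.add_apply, Pi.smul_apply, Pi.sub_apply, smul_eq_mul,
          Finset.sum_add_distrib, ← Finset.mul_sum, Finset.sum_sub_distrib]
      rw [e, partSum_natCast, partSum_edgeVector, if_neg hu, if_neg hv.1] at h1
      push_cast at h1
      by_contra! hge
      nlinarith
    have hzpos (v : V) : 0 < z v := by
      have := mul_pos hmR (hxpos v)
      rw [← hzx] at this
      exact_mod_cast this
    lift z to V → ℕ using fun v => (hzpos v).le
    have hzx' : (fun v => (z v : ℝ)) = fun v => m * x v := by
      ext v; simpa using hzx v
    refine ⟨z, ?_, fun v => Int.natCast_pos.1 (hzpos v), fun i => ?_⟩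
    · have : ((∑ v, z v : ℕ) : ℝ) = ((2 * m : ℕ) : ℝ) := by
        push_cast
        rw [show ∑ v, (z v : ℝ) = ∑ v, m * x v from congrArg (fun f => ∑ v, f v) hzx',
          ← Finset.mul_sum, hQ.1]
        ring
      exact_mod_cast this
    · have : ((partSum π z i : ℕ) : ℝ) < m := by
        rw [← partSum_natCast, hzx', partSum, ← Finset.mul_sum]
        have := mul_lt_mul_of_pos_left (hxlt i) hmR
        rwa [mul_one] at this
      exact_mod_cast this
  · rintro ⟨z, hz⟩
    obtain ⟨m, rfl⟩ := Nat.exists_eq_succ_of_ne_zero hm.ne'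
    obtain ⟨u₀, -⟩ := hthird ∅ (by simp)
    obtain ⟨v₀, hv₀⟩ := hthird {π u₀} (by simp)
    have hadj : G.Adj u₀ v₀ := (hG _ _).2 fun h => hv₀ (by simp [h])
    have hne : G.edgePolytope.Nonempty := ⟨_, natCast_edgeVector_mem_edgePolytope hadj⟩
    obtain ⟨x, hx, hzx⟩ := exists_smul_eq_of_mem_dilateLatticePoints hG hne
      (⟨hz.1, fun i => (hz.2.2 i).le⟩ : z ∈ dilateLatticePoints π (m + 1))
    refine ⟨fun v => (z v : ℤ), x, ?_, ?_⟩
    · refine mem_intrinsicInterior_convexHull (convexHull_nonempty_iff.1 hne) hx ?_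
      rintro _ ⟨u, v, huv, rfl⟩
      obtain ⟨w, hw, rfl⟩ := sub_edgeVector_mem_dilateLatticePoints hz ((hG u v).1 huv)
      -- `m = 0` is impossible for a strictly positive `z`, since there are at least three vertices.
      have hm0 : 0 < m := by
        by_contra h
        have h1 := hz.2.1 u
        have h2 := hz.2.2 (π u)
        have h3 : (edgeVector u v + w) u ≤ partSum π (edgeVector u v + w) (π u) :=
          Finset.single_le_sum (f := edgeVector u v + w) (fun _ _ => Nat.zero_le _) (by simp)
        omega
      have hm0R : (0 : ℝ) < m := by exact_mod_cast hm0
      obtain ⟨y, hy, hwy⟩ := exists_smul_eq_of_mem_dilateLatticePoints hG hne hw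
      refine ⟨1 / m, by positivity, ?_⟩
      have e : x + (1 / m : ℝ) • (x - (Pi.single u 1 + Pi.single v 1)) = y := by
        ext a
        have h1 := congrFun hwy a
        have h2 := congrFun hzx a
        have h3 := congrFun (natCast_edgeVector u v) a
        simp only [Pi.smul_apply, smul_eq_mul] at h1 h2
        simp only [Pi.add_apply, Nat.cast_add, h1, h3] at h2
        simp only [Pi.add_apply, Pi.smul_apply, Pi.sub_apply, smul_eq_mul] at h2 ⊢
        push_cast at h2
        field_simp
        linarith
      rw [e]
      exact hy
    · ext v
      simpa using (congrFun hzx v).symm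

end EdgePolytope

/-! ### The first dilate with interior lattice points -/

section CompleteMultipartite

variable {V ι : Type*} [Fintype V] [DecidableEq ι]

lemma finite_strictLatticePoints (π : V → ι) (m : ℕ) : (strictLatticePoints π m).Finite :=
  (finite_boundedCompositions V 1 (2 * m)).subset fun _ hz => ⟨hz.1, hz.2.1⟩

/-- The first dilate containing points with strict inequalities determines the `a`-invariant, and
the number of these points is the leading coefficient of the `h`-polynomial. -/
theorem exists_hPolynomial_of_strictLatticePoints [Fintype ι] (k : Type*) [Field k]
    {G : SimpleGraph V} {π : V → ι} (hG : ∀ u v, G.Adj u v ↔ π u ≠ π v)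
    (hπ : Function.Surjective π) (hι : 2 < Fintype.card ι) {l : ℕ} (hl : 0 < l)
    (hlV : l ≤ Fintype.card V) (hne : (strictLatticePoints π l).Nonempty)
    (hmin : ∀ m, (strictLatticePoints π m).Nonempty → l ≤ m) :
    ∃ h : Polynomial ℤ, G.IsInteriorDegree l ∧ G.IsEdgeRingHPolynomial k h ∧
      G.IsEdgeRingAInvariant k (-(l : ℤ)) ∧
      h.leadingCoeff = (strictLatticePoints π l).ncard := by
  obtain ⟨p, hp, hpos, hneg⟩ := exists_ehrhart_polynomial π hπ hι
  have hl0 : ((strictLatticePoints π l).ncard : ℤ) ≠ 0 := by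
    exact_mod_cast (Set.ncard_pos (finite_strictLatticePoints π l)).2 hne |>.ne'
  obtain ⟨h, hser, hdeg, hlead⟩ := exists_hPolynomial_of_reciprocity
    (fun m => (dilateLatticePoints π m).ncard) (fun m => (strictLatticePoints π m).ncard)
    p _ l hp hpos hneg hl hlV
    (fun m _ hml => by
      have : strictLatticePoints π m = ∅ := by
        by_contra hcon
        exact absurd (hmin m (Set.nonempty_iff_ne_empty.2 hcon)) (not_le.2 hml)
      simp [this]) hl0
  have hHilb : G.edgeRingHilbertSeries k
      = PowerSeries.mk fun m => ((dilateLatticePoints π m).ncard : ℤ) := by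
    ext m
    simp [SimpleGraph.edgeRingHilbertSeries, finrank_edgeRingPiece k hG]
  have htri (v : V) : ∃ u w, G.Adj u v ∧ G.Adj v w ∧ G.Adj u w := by
    have hthird := exists_apply_notMem_of_card_le_two hπ hι
    obtain ⟨u, hu⟩ := hthird {π v} (by simp)
    obtain ⟨w, hw⟩ := hthird {π v, π u} Finset.card_le_two
    simp only [Finset.mem_insert, Finset.mem_singleton, not_or] at hu hw
    exact ⟨u, w, (hG u v).2 hu, (hG v w).2 (Ne.symm hw.1), (hG u w).2 (Ne.symm hw.2)⟩
  refine ⟨h, ⟨⟨hl, ?_⟩, ?_⟩, ⟨_, ringKrullDim_edgeRing k htri, by rw [hHilb]; exact hser⟩,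
    ⟨h, (1 - Polynomial.X) ^ Fintype.card V, ?_, ?_, ?_, ?_⟩, hlead⟩
  · exact (interiorLatticePoints_nonempty_iff hG hπ hι hl).2 hne
  · rintro m ⟨hm, hm'⟩
    exact hmin m ((interiorLatticePoints_nonempty_iff hG hπ hι hm).1 hm')
  · rintro rfl
    exact hl0 (by rw [← hlead]; simp)
  · refine pow_ne_zero _ fun h1 => ?_
    have := congrArg (Polynomial.eval 0) h1
    simp at this
  · rw [hHilb, ← hser]
    simp
  · have e : (1 - Polynomial.X : Polynomial ℤ) = -(Polynomial.X - Polynomial.C 1) := by simp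
    rw [Polynomial.natDegree_pow, e, Polynomial.natDegree_neg, Polynomial.natDegree_X_sub_C, hdeg]
    omega

lemma partSum_le_partSum (π : V → ι) {z w : V → ℕ} (h : z ≤ w) (i : ι) :
    partSum π z i ≤ partSum π w i :=
  Finset.sum_le_sum fun v _ => h v

/-- If adding `e` to the coordinate at any vertex outside the part `i₀` turns the all-ones vector
into a strict lattice point, there are at least two strict lattice points, since there are at
least two parts other than `i₀`. -/
lemma two_le_ncard_strictLatticePoints [Fintype ι] [DecidableEq V] {π : V → ι}
    (hπ : Function.Surjective π) (hι : 2 < Fintype.card ι) {l e : ℕ} (he : 0 < e) (i₀ : ι)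
    (hmem : ∀ v, π v ≠ i₀ → (1 + Pi.single v e : V → ℕ) ∈ strictLatticePoints π l) :
    2 ≤ (strictLatticePoints π l).ncard := by
  obtain ⟨i, j, hi, hj, hij⟩ : ∃ i j, i ≠ i₀ ∧ j ≠ i₀ ∧ i ≠ j := by
    have : 1 < (Finset.univ.erase i₀).card := by
      rw [Finset.card_erase_of_mem (Finset.mem_univ _), Finset.card_univ]; omega
    obtain ⟨i, hi, j, hj, hij⟩ := Finset.one_lt_card.1 this
    exact ⟨i, j, Finset.ne_of_mem_erase hi, Finset.ne_of_mem_erase hj, hij⟩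
  obtain ⟨u, rfl⟩ := hπ i
  obtain ⟨v, rfl⟩ := hπ j
  have huv : u ≠ v := fun h => hij (by rw [h])
  refine (Set.one_lt_ncard_iff (finite_strictLatticePoints π l)).2
    ⟨_, _, hmem u hi, hmem v hj, fun h => ?_⟩
  have h1 := congrFun h u
  simp [huv] at h1
  omega

/-- The first dilate with strict lattice points and their number there, in terms of the part
sizes. The last hypothesis is the only consequence of the restrictions on the number and the sizes
of the parts that matters: any two parts leave out at least two vertices. -/
theorem exists_first_strictLatticePoints [Fintype ι] (π : V → ι) (hπ : Function.Surjective π)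
    (hι : 2 < Fintype.card ι) (i₀ : ι)
    (hmax : ∀ i, partSum π 1 i ≤ partSum π (1 : V → ℕ) i₀)
    (htwo : ∀ i j, i ≠ j → partSum π (1 : V → ℕ) i + partSum π 1 j + 2 ≤ Fintype.card V) :
    ∃ l, 0 < l ∧ l ≤ Fintype.card V ∧ (strictLatticePoints π l).Nonempty ∧
      (∀ m, (strictLatticePoints π m).Nonempty → l ≤ m) ∧
      (2 * partSum π 1 i₀ < Fintype.card V → Even (Fintype.card V) →
        l = Fintype.card V / 2 ∧ (strictLatticePoints π l).ncard = 1) ∧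
      (2 * partSum π 1 i₀ < Fintype.card V → Odd (Fintype.card V) →
        l = (Fintype.card V + 1) / 2 ∧ 2 ≤ (strictLatticePoints π l).ncard) ∧
      (Fintype.card V ≤ 2 * partSum π 1 i₀ →
        l = partSum π 1 i₀ + 1 ∧ 2 ≤ (strictLatticePoints π l).ncard) := by
  classical
  have hsum1 : ∑ v : V, (1 : V → ℕ) v = Fintype.card V := by simp
  have hge {m : ℕ} {z : V → ℕ} (hz : z ∈ strictLatticePoints π m) : (1 : V → ℕ) ≤ z := hz.2.1
  have hcard {m : ℕ} (h : (strictLatticePoints π m).Nonempty) : Fintype.card V ≤ 2 * m := by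
    obtain ⟨z, hz⟩ := h
    rw [← hz.1, ← hsum1]
    exact Finset.sum_le_sum fun v _ => hge hz v
  obtain ⟨j₀, hj₀⟩ : ∃ j₀, i₀ ≠ j₀ := by
    have : Nontrivial ι := Fintype.one_lt_card_iff_nontrivial.1 (by omega)
    obtain ⟨j, hj⟩ := exists_ne i₀
    exact ⟨j, hj.symm⟩
  have hij₀ := htwo i₀ j₀ hj₀
  -- The vectors `1 + Pi.single v e` with `v` outside the largest part supply the strict lattice points.
  have hpoint {l e : ℕ} (hl : Fintype.card V + e = 2 * l) (h₀ : partSum π 1 i₀ < l)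
      (h₁ : ∀ i, i ≠ i₀ → partSum π (1 : V → ℕ) i + e < l) (v : V) (hv : π v ≠ i₀) :
      (1 + Pi.single v e : V → ℕ) ∈ strictLatticePoints π l := by
    refine ⟨?_, fun w => ?_, fun i => ?_⟩
    · rw [← hl, ← hsum1]
      simp [Finset.sum_add_distrib, Finset.sum_pi_single']
    · simp
    · rw [partSum_add, partSum_single]
      split_ifs with h
      · exact h ▸ h₁ _ hv
      · exact (hmax i).trans_lt h₀
  have hnonempty {l : ℕ} (h : 2 ≤ (strictLatticePoints π l).ncard) :
      (strictLatticePoints π l).Nonempty :=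
    (Set.ncard_pos (finite_strictLatticePoints π l)).1 (by omega)
  rcases lt_or_ge (2 * partSum π 1 i₀) (Fintype.card V) with hlt | hlarge
  · rcases Nat.even_or_odd (Fintype.card V) with heven | hodd
    · obtain ⟨l, hl⟩ := heven
      have hone : strictLatticePoints π l = {1} := by
        ext z
        rw [Set.mem_singleton_iff]
        constructor
        · intro hz
          have h2 : ∑ v, (1 : V → ℕ) v = ∑ v, z v := by rw [hsum1, hz.1]; omega
          ext v
          exact ((Finset.sum_eq_sum_iff_of_le fun v _ => hge hz v).1 h2 v (Finset.mem_univ v)).symm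
        · rintro rfl
          refine ⟨by rw [hsum1]; omega, fun v => Nat.one_pos, fun i => ?_⟩
          have := hmax i
          omega
      refine ⟨l, by omega, by omega, by simp [hone], fun m hm => by have := hcard hm; omega,
        fun _ _ => ⟨by omega, by simp [hone]⟩, fun _ ho => ?_, fun h => by omega⟩
      obtain ⟨c, hc⟩ := ho
      omega
    · obtain ⟨l, hl⟩ := hodd
      have htwopts : 2 ≤ (strictLatticePoints π (l + 1)).ncard :=
        two_le_ncard_strictLatticePoints hπ hι one_pos i₀
          (hpoint (by omega) (by omega) fun i hi => by
            have := htwo i i₀ hi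
            have := hmax i
            omega)
      refine ⟨l + 1, by omega, by omega, hnonempty htwopts,
        fun m hm => by have := hcard hm; omega, fun _ he => ?_,
        fun _ _ => ⟨by omega, htwopts⟩, fun h => by omega⟩
      obtain ⟨c, hc⟩ := he
      omega
  · have htwopts : 2 ≤ (strictLatticePoints π (partSum π 1 i₀ + 1)).ncard :=
      two_le_ncard_strictLatticePoints hπ hι
        (e := 2 * partSum π 1 i₀ + 2 - Fintype.card V) (by omega) i₀
        (hpoint (by omega) (by omega) fun i hi => by
          have := htwo i i₀ hi
          omega)
    refine ⟨_, Nat.succ_pos _, by omega, hnonempty htwopts, ?_, fun h => by omega,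
      fun h => by omega, fun _ => ⟨rfl, htwopts⟩⟩
    rintro m ⟨z, hz⟩
    have h1 := partSum_le_partSum π (hge hz) i₀
    have h2 := hz.2.2 i₀
    omega

end CompleteMultipartite

theorem proposition4p2 (k : Type*) [Field k] (n : ℕ) (hn : 3 ≤ n) (r : Fin n → ℕ)
    (hr_pos : ∀ i, 1 ≤ r i) (hr_mono : Monotone r)
    (hnr : (n = 3 ∧ 2 ≤ r ⟨0, by omega⟩) ∨ 4 ≤ n)
    (d : ℕ) (hd : d = ∑ i, r i)
    (rn : ℕ) (hrn : rn = r ⟨n - 1, by omega⟩)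
    (G : SimpleGraph (Σ i : Fin n, Fin (r i)))
    (hG : G = SimpleGraph.completeMultipartiteGraph fun i : Fin n => Fin (r i)) :
    ∃ (l : ℕ) (h : Polynomial ℤ),
      G.IsInteriorDegree l ∧ G.IsEdgeRingHPolynomial k h ∧
      G.IsEdgeRingAInvariant k (-(l : ℤ)) ∧
      (2 * rn < d → Even d → l = d / 2 ∧ h.leadingCoeff = 1) ∧
      (2 * rn < d → Odd d → l = (d + 1) / 2 ∧ 2 ≤ h.leadingCoeff) ∧
      (d ≤ 2 * rn → l = rn + 1 ∧ 2 ≤ h.leadingCoeff) := by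
  set π : (Σ i : Fin n, Fin (r i)) → Fin n := Sigma.fst
  have hadj (u v) : G.Adj u v ↔ π u ≠ π v := by rw [hG]; rfl
  have hπ : Function.Surjective π := fun i => ⟨⟨i, ⟨0, hr_pos i⟩⟩, rfl⟩
  have hι : 2 < Fintype.card (Fin n) := by rw [Fintype.card_fin]; omega
  have hcard : Fintype.card (Σ i : Fin n, Fin (r i)) = d := by simp [hd]
  have hpart (i : Fin n) : partSum π (1 : (Σ i : Fin n, Fin (r i)) → ℕ) i = r i := by
    rw [partSum, Finset.sum_filter, Fintype.sum_sigma, Fintype.sum_eq_single i]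
    · simp [π]
    · intro j hj
      simp [π, hj]
  have hlast (i : Fin n) : r i ≤ r ⟨n - 1, by omega⟩ :=
    hr_mono (Fin.mk_le_mk.2 (by omega) : i ≤ ⟨n - 1, _⟩)
  have htwo (i j : Fin n) (hij : i ≠ j) : r i + r j + 2 ≤ d := by
    have hsub := Finset.sum_add_sum_compl {i, j} r
    rw [Finset.sum_pair hij, ← hd] at hsub
    have hc : ({i, j} : Finset (Fin n))ᶜ.card = n - 2 := by
      rw [Finset.card_compl, Finset.card_pair hij, Fintype.card_fin]
    have h2 : 2 ≤ ∑ x ∈ ({i, j} : Finset (Fin n))ᶜ, r x := by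
      rcases hnr with ⟨h3, hr0⟩ | h4
      · have := Finset.card_nsmul_le_sum ({i, j} : Finset (Fin n))ᶜ r 2 fun x _ =>
          hr0.trans (hr_mono (Fin.mk_le_mk.2 (Nat.zero_le _) : (⟨0, _⟩ : Fin n) ≤ x))
        rw [hc, smul_eq_mul] at this
        exact le_trans (by omega) this
      · have := Finset.card_nsmul_le_sum ({i, j} : Finset (Fin n))ᶜ r 1 fun x _ => hr_pos x
        rw [hc, smul_eq_mul] at this
        exact le_trans (by omega) this
    omega
  obtain ⟨l, hl, hld, hne, hmin, ha, hb, hc⟩ := exists_first_strictLatticePoints π hπ hι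
    ⟨n - 1, by omega⟩ (fun i => by rw [hpart, hpart]; exact hlast i)
    (fun i j hij => by rw [hpart, hpart, hcard]; exact htwo i j hij)
  obtain ⟨h, hint, hpoly, hainv, hlead⟩ :=
    exists_hPolynomial_of_strictLatticePoints k hadj hπ hι hl hld hne hmin
  rw [hpart, hcard, ← hrn] at ha hb hc
  refine ⟨l, h, hint, hpoly, hainv, fun h1 h2 => ?_, fun h1 h2 => ?_, fun h1 => ?_⟩
  · obtain ⟨h3, h4⟩ := ha h1 h2
    exact ⟨h3, by rw [hlead, h4]; rfl⟩
  · obtain ⟨h3, h4⟩ := hb h1 h2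
    exact ⟨h3, by rw [hlead]; exact_mod_cast h4⟩
  · obtain ⟨h3, h4⟩ := hc h1
    exact ⟨h3, by rw [hlead]; exact_mod_cast h4⟩
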